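/- An MV-algebra is a structure $(A,\oplus,{}^*,0)$ such that $(A,\oplus,0)$ is an abelian monoid, $x^{**}=x$, $(x^*\oplus y)^*\oplus y=(y^*\oplus x)^*\oplus x$ and $0^*\oplus x=0^*$; put $x\odot y=(x^*\oplus y^*)^*$. A DMV-algebra is an MV-algebra with unary operators $\delta_n$ ($n\ge 1$) such that $n\,\delta_n x=x$ and $\delta_n x\odot (n-1)\delta_n x=0$ for all $x$, where $k\,y$ denotes the $k$-fold sum $y\oplus\dots\oplus y$. Let $\mathbf{MV}$ and $\mathbf{DMV}$ be the categories of MV-algebras and of DMV-algebras with their homomorphisms (maps preserving all operations). A strong unit of an abelian lattice-ordered group $G$ is an element $u\ge 0$ such that for every $x\in G$ there is $n\in\mathbb N$ with $|x|\le nu$. Let $\mathbf{uAG}$ be the category of pairs $(G,u)$, with $G$ an abelian lattice-ordered group and $u$ a strong unit of $G$, whose morphisms are the lattice-ordered group homomorphisms that preserve the distinguished units. Let $\mathbf{uQVL}$ be the category of pairs $(V,u)$, with $V$ a lattice-ordered vector space over $\mathbb Q$ and $u$ a strong unit of $V$, whose morphisms are the $\mathbb Q$-linear lattice homomorphisms that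 preserve the distinguished units. Let $\Gamma:\mathbf{uAG}\to\mathbf{MV}$ be Mundici's functor: $\Gamma(G,u)$ is $[0,u]_G=\{x\in G\mid 0\le x\le u\}$ with $x\oplus y=u\wedge(x+y)$ and $x^*=u-x$, and $\Gamma(h)$ is the restriction of $h$ to the unit interval. **Theorem.** Mundici's categorical equivalence $\Gamma$ extends to $\mathbf{uQVL}$ and $\mathbf{DMV}$. That is, let $\Gamma_{\mathbb Q}:\mathbf{uQVL}\to\mathbf{DMV}$ be the functor with $\Gamma_{\mathbb Q}(V,u)=[0,u]_V$, with the MV-operations above and $\delta_n x=\frac1n x$, and $\Gamma_{\mathbb Q}(f)=f|_{[0,u]_V}$ for every arrow $f:(V,u)\to(W,w)$. Then $\Gamma_{\mathbb Q}$ commutes with $\Gamma$ and the forgetful functors $\mathbf{DMV}\to\mathbf{MV}$ and $\mathbf{uQVL}\to\mathbf{uAG}$ (that is, the MV-reduct of $\Gamma_{\mathbb Q}(V,u)$ is $\Gamma(V,u)$, and likewise for arrows), and $\Gamma_{\mathbb Q}$ is an equivalence of categories. -/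

import Mathlib

open CategoryTheory

universe u

/-! ### MV-algebras and DMV-algebras -/

/-- An MV-algebra `(A, ⊕, *, 0)`. The operation `⊕` is written `+`, and `x*` is written `xᶜ`;
thus `n • x` is the `n`-fold sum `x ⊕ ⋯ ⊕ x`. -/
class MVAlgebra (A : Type u) extends AddCommMonoid A, Compl A where
  compl_compl' : ∀ x : A, xᶜᶜ = x
  luk : ∀ x y : A, (xᶜ + y)ᶜ + y = (yᶜ + x)ᶜ + x
  compl_zero_add : ∀ x : A, (0 : A)ᶜ + x = (0 : A)ᶜ

/-- The operation `x ⊙ y = (x* ⊕ y*)*`. -/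
def MVAlgebra.odot {A : Type u} [MVAlgebra A] (x y : A) : A := (xᶜ + yᶜ)ᶜ

/-- A DMV-algebra: an MV-algebra with unary operators `δ n`, for the integers `n ≥ 1`, such that
`n (δ n x) = x` and `δ n x ⊙ (n - 1) (δ n x) = 0`. -/
class DMVAlgebra (A : Type u) extends MVAlgebra A where
  δ : ℕ+ → A → A
  nsmul_δ : ∀ (n : ℕ+) (x : A), (n : ℕ) • δ n x = x
  odot_δ : ∀ (n : ℕ+) (x : A), MVAlgebra.odot (δ n x) (((n : ℕ) - 1) • δ n x) = 0

/-- Homomorphisms of MV-algebras: maps preserving `0`, `⊕` and `*`. -/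
structure MVHom (A B : Type u) [MVAlgebra A] [MVAlgebra B] extends A →+ B where
  map_compl' : ∀ x : A, toFun xᶜ = (toFun x)ᶜ

/-- Homomorphisms of DMV-algebras: homomorphisms of MV-algebras preserving every `δ n`. -/
structure DMVHom (A B : Type u) [DMVAlgebra A] [DMVAlgebra B] extends MVHom A B where
  map_δ' : ∀ (n : ℕ+) (x : A), toFun (DMVAlgebra.δ n x) = DMVAlgebra.δ n (toFun x)

/-- The category of MV-algebras: objects. -/
structure MVCat where
  carrier : Type u
  [str : MVAlgebra carrier]

attribute [instance] MVCat.str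

instance : Category MVCat.{u} where
  Hom A B := MVHom A.carrier B.carrier
  id A := { toAddMonoidHom := AddMonoidHom.id A.carrier, map_compl' := fun _ => rfl }
  comp f g :=
    { toAddMonoidHom := g.toAddMonoidHom.comp f.toAddMonoidHom
      map_compl' := fun x =>
        (congrArg g.toFun (f.map_compl' x)).trans (g.map_compl' (f.toFun x)) }

/-- The category of DMV-algebras: objects. -/
structure DMVCat where
  carrier : Type u
  [str : DMVAlgebra carrier]

attribute [instance] DMVCat.str

instance : Category DMVCat.{u} where
  Hom A B := DMVHom A.carrier B.carrier
  id A :=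
    { toAddMonoidHom := AddMonoidHom.id A.carrier
      map_compl' := fun _ => rfl
      map_δ' := fun _ _ => rfl }
  comp f g :=
    { toAddMonoidHom := g.toAddMonoidHom.comp f.toAddMonoidHom
      map_compl' := fun x =>
        (congrArg g.toFun (f.map_compl' x)).trans (g.map_compl' (f.toFun x))
      map_δ' := fun n x =>
        (congrArg g.toFun (f.map_δ' n x)).trans (g.map_δ' n (f.toFun x)) }

/-- The forgetful functor sending a DMV-algebra to its MV-algebra reduct. -/
def DMVCat.forgetToMV : DMVCat.{u} ⥤ MVCat.{u} where
  obj A := { carrier := A.carrier }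
  map f := f.toMVHom

/-! ### Lattice-ordered groups and vector lattices with strong unit -/

/-- `e` is a strong unit of the abelian lattice-ordered group `G`. -/
def IsStrongUnit {G : Type u} [AddCommGroup G] [Lattice G] (e : G) : Prop :=
  0 ≤ e ∧ ∀ x : G, ∃ n : ℕ, |x| ≤ n • e

/-- The category of abelian lattice-ordered groups with a distinguished strong unit: objects. -/
structure UAG where
  carrier : Type u
  [group : AddCommGroup carrier]
  [lattice : Lattice carrier]
  [ordered : IsOrderedAddMonoid carrier]
  unit : carrier
  isStrongUnit : IsStrongUnit unit

attribute [instance] UAG.group UAG.lattice UAG.ordered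

/-- Homomorphisms of lattice-ordered groups that preserve the strong unit. -/
structure UAG.Hom (G H : UAG.{u}) extends G.carrier →+ H.carrier where
  map_sup' : ∀ x y : G.carrier, toFun (x ⊔ y) = toFun x ⊔ toFun y
  map_inf' : ∀ x y : G.carrier, toFun (x ⊓ y) = toFun x ⊓ toFun y
  map_unit' : toFun G.unit = H.unit

instance : Category UAG.{u} where
  Hom G H := UAG.Hom G H
  id G :=
    { toAddMonoidHom := AddMonoidHom.id G.carrier
      map_sup' := fun _ _ => rfl
      map_inf' := fun _ _ => rfl
      map_unit' := rfl }
  comp f g :=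
    { toAddMonoidHom := g.toAddMonoidHom.comp f.toAddMonoidHom
      map_sup' := fun x y => (congrArg g.toFun (f.map_sup' x y)).trans (g.map_sup' _ _)
      map_inf' := fun x y => (congrArg g.toFun (f.map_inf' x y)).trans (g.map_inf' _ _)
      map_unit' := (congrArg g.toFun f.map_unit').trans g.map_unit' }

/-- The category of `ℚ`-vector lattices with a distinguished strong unit: objects. -/
structure UQVL where
  carrier : Type u
  [group : AddCommGroup carrier]
  [lattice : Lattice carrier]
  [ordered : IsOrderedAddMonoid carrier]
  [module : Module ℚ carrier]
  [orderedModule : IsOrderedModule ℚ carrier]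
  unit : carrier
  isStrongUnit : IsStrongUnit unit

attribute [instance] UQVL.group UQVL.lattice UQVL.ordered UQVL.module UQVL.orderedModule

/-- `ℚ`-linear lattice homomorphisms that preserve the strong unit. -/
structure UQVL.Hom (V W : UQVL.{u}) extends V.carrier →ₗ[ℚ] W.carrier where
  map_sup' : ∀ x y : V.carrier, toFun (x ⊔ y) = toFun x ⊔ toFun y
  map_inf' : ∀ x y : V.carrier, toFun (x ⊓ y) = toFun x ⊓ toFun y
  map_unit' : toFun V.unit = W.unit

instance : Category UQVL.{u} where
  Hom V W := UQVL.Hom V W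
  id V :=
    { toLinearMap := LinearMap.id
      map_sup' := fun _ _ => rfl
      map_inf' := fun _ _ => rfl
      map_unit' := rfl }
  comp f g :=
    { toLinearMap := g.toLinearMap.comp f.toLinearMap
      map_sup' := fun x y => (congrArg g.toFun (f.map_sup' x y)).trans (g.map_sup' _ _)
      map_inf' := fun x y => (congrArg g.toFun (f.map_inf' x y)).trans (g.map_inf' _ _)
      map_unit' := (congrArg g.toFun f.map_unit').trans g.map_unit' }

/-- The forgetful functor from `ℚ`-vector lattices to lattice-ordered groups with strong unit. -/
def UQVL.forgetToUAG : UQVL.{u} ⥤ UAG.{u} where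
  obj V := { carrier := V.carrier, unit := V.unit, isStrongUnit := V.isStrongUnit }
  map f :=
    { toAddMonoidHom := f.toLinearMap.toAddMonoidHom
      map_sup' := f.map_sup'
      map_inf' := f.map_inf'
      map_unit' := f.map_unit' }

/-! ### The unit interval of a lattice-ordered group -/

namespace Gamma

section Interval

variable {G : Type u} [AddCommGroup G] [Lattice G] [IsOrderedAddMonoid G] {e : G}

theorem inf_trunc_add (a : G) {z : G} (hz : 0 ≤ z) : e ⊓ (e ⊓ a + z) = e ⊓ (a + z) := by
  rw [inf_add, ← inf_assoc, inf_eq_left.2 (le_add_of_nonneg_right hz)]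

theorem luk_aux (x y : G) : e - e ⊓ (e - x + y) + y = x ⊔ y := by
  have h : e ⊓ (e - x + y) = e - (x - y) ⊔ 0 := by
    rw [sub_eq_add_neg e ((x - y) ⊔ 0), neg_sup, add_inf, neg_zero, add_zero, inf_comm]
    congr 1
    abel
  rw [h, sub_sub_cancel, sup_add, sub_add_cancel, zero_add]

/-- The interval `[0, e]` with `x ⊕ y = e ∧ (x + y)` and `x* = e - x`; then the `n`-fold sum
`x ⊕ ⋯ ⊕ x` is `e ∧ n x`. -/
@[reducible] def mvAlgebra (he : 0 ≤ e) : MVAlgebra (Set.Icc (0 : G) e) where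
  add x y := ⟨e ⊓ (x.1 + y.1), le_inf he (add_nonneg x.2.1 y.2.1), inf_le_left⟩
  zero := ⟨0, le_rfl, he⟩
  compl x := ⟨e - x.1, sub_nonneg.2 x.2.2, sub_le_self _ x.2.1⟩
  nsmul n x := ⟨e ⊓ n • x.1, le_inf he (nsmul_nonneg x.2.1 n), inf_le_left⟩
  nsmul_zero x := Subtype.ext <| by
    change e ⊓ 0 • x.1 = 0
    rw [zero_smul, inf_eq_right.2 he]
  nsmul_succ n x := Subtype.ext <| by
    change e ⊓ (n + 1) • x.1 = e ⊓ (e ⊓ n • x.1 + x.1)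
    rw [succ_nsmul, inf_trunc_add _ x.2.1]
  add_assoc x y z := Subtype.ext <| by
    change e ⊓ (e ⊓ (x.1 + y.1) + z.1) = e ⊓ (x.1 + e ⊓ (y.1 + z.1))
    rw [inf_trunc_add _ z.2.1, add_comm x.1 (e ⊓ _), inf_trunc_add _ x.2.1]
    congr 1
    abel
  zero_add x := Subtype.ext <| by
    change e ⊓ (0 + x.1) = x.1
    rw [zero_add, inf_eq_right.2 x.2.2]
  add_zero x := Subtype.ext <| by
    change e ⊓ (x.1 + 0) = x.1
    rw [add_zero, inf_eq_right.2 x.2.2]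
  add_comm x y := Subtype.ext <| by
    change e ⊓ (x.1 + y.1) = e ⊓ (y.1 + x.1)
    rw [add_comm]
  compl_compl' x := Subtype.ext <| sub_sub_cancel e x.1
  luk x y := Subtype.ext <| by
    change e ⊓ (e - e ⊓ (e - x.1 + y.1) + y.1) = e ⊓ (e - e ⊓ (e - y.1 + x.1) + x.1)
    rw [luk_aux, luk_aux, sup_comm]
  compl_zero_add x := Subtype.ext <| by
    change e ⊓ (e - 0 + x.1) = e - 0
    rw [sub_zero, inf_eq_left.2 (le_add_of_nonneg_right x.2.1)]

end Interval

section Rational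

theorem nsmul_inv_smul {V : Type u} [AddCommGroup V] [Module ℚ V] (n : ℕ+) (x : V) :
    (n : ℕ) • ((n : ℕ) : ℚ)⁻¹ • x = x := by
  rw [← Nat.cast_smul_eq_nsmul ℚ, smul_inv_smul₀ (Nat.cast_ne_zero.2 n.ne_zero)]

variable {V : Type u} [AddCommGroup V] [Lattice V] [IsOrderedAddMonoid V]
  [Module ℚ V] [IsOrderedModule ℚ V] {e : V}

theorem inv_smul_mem (n : ℕ+) (x : Set.Icc (0 : V) e) :
    ((n : ℕ) : ℚ)⁻¹ • x.1 ∈ Set.Icc (0 : V) e := by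
  have h0 : (0 : V) ≤ ((n : ℕ) : ℚ)⁻¹ • x.1 := smul_nonneg (by positivity) x.2.1
  refine ⟨h0, le_trans ?_ x.2.2⟩
  conv_rhs => rw [← nsmul_inv_smul n x.1]
  exact le_self_nsmul h0 n.ne_zero

/-- The interval `[0, e]` of a `ℚ`-vector lattice, with `δ n x = (1/n) x`. -/
@[reducible] def dmvAlgebra (he : 0 ≤ e) : DMVAlgebra (Set.Icc (0 : V) e) where
  toMVAlgebra := mvAlgebra he
  δ n x := ⟨((n : ℕ) : ℚ)⁻¹ • x.1, inv_smul_mem n x⟩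
  nsmul_δ n x := Subtype.ext <| by
    change e ⊓ (n : ℕ) • ((n : ℕ) : ℚ)⁻¹ • x.1 = x.1
    rw [nsmul_inv_smul, inf_eq_right.2 x.2.2]
  odot_δ n x := Subtype.ext <| by
    set y : V := ((n : ℕ) : ℚ)⁻¹ • x.1 with hy
    change e - e ⊓ ((e - y) + (e - e ⊓ ((n : ℕ) - 1) • y)) = 0
    have hx : y + ((n : ℕ) - 1) • y = x.1 := by
      rw [← succ_nsmul', Nat.sub_add_cancel n.pos]
      exact nsmul_inv_smul n x.1
    have h : y + e ⊓ ((n : ℕ) - 1) • y ≤ e :=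
      (add_le_add_right inf_le_right _).trans (hx.le.trans x.2.2)
    have h3 : (e - y) + (e - e ⊓ ((n : ℕ) - 1) • y)
        = e + (e - (y + e ⊓ ((n : ℕ) - 1) • y)) := by abel
    rw [h3, inf_eq_left.2 (le_add_of_nonneg_right (sub_nonneg.2 h)), sub_self]

end Rational

theorem map_mem {G H : UAG.{u}} (f : UAG.Hom G H) (x : Set.Icc (0 : G.carrier) G.unit) :
    f.toFun x.1 ∈ Set.Icc (0 : H.carrier) H.unit := by
  constructor
  · have h := f.map_inf' 0 x.1
    rw [inf_eq_left.2 x.2.1, f.map_zero'] at h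
    exact inf_eq_left.1 h.symm
  · have h := f.map_inf' x.1 G.unit
    rw [inf_eq_left.2 x.2.2, f.map_unit'] at h
    exact inf_eq_left.1 h.symm

end Gamma

/-- Mundici's functor `Γ`: `(G, u) ↦ [0, u]` and `h ↦ h` restricted to `[0, u]`. -/
def gamma : UAG.{u} ⥤ MVCat.{u} where
  obj G :=
    { carrier := Set.Icc (0 : G.carrier) G.unit
      str := Gamma.mvAlgebra G.isStrongUnit.1 }
  map {G H} f :=
    letI := Gamma.mvAlgebra G.isStrongUnit.1
    letI := Gamma.mvAlgebra H.isStrongUnit.1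
    { toFun := fun x => ⟨f.toFun x.1, Gamma.map_mem f x⟩
      map_zero' := Subtype.ext f.map_zero'
      map_add' := fun x y => Subtype.ext <| by
        change f.toFun (G.unit ⊓ (x.1 + y.1)) = H.unit ⊓ (f.toFun x.1 + f.toFun y.1)
        rw [f.map_inf', f.map_unit']
        exact congrArg _ (f.map_add' _ _)
      map_compl' := fun x => Subtype.ext <| by
        change f.toFun (G.unit - x.1) = H.unit - f.toFun x.1
        exact (f.toAddMonoidHom.map_sub _ _).trans (congrArg (· - f.toFun x.1) f.map_unit') }

/-- The functor `Γ_ℚ`: `(V, u) ↦ [0, u]`, with `δ n x = (1/n) x`, and `f ↦ f` restricted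
to `[0, u]`. -/
def gammaQ : UQVL.{u} ⥤ DMVCat.{u} where
  obj V :=
    { carrier := Set.Icc (0 : V.carrier) V.unit
      str := Gamma.dmvAlgebra V.isStrongUnit.1 }
  map {V W} f :=
    letI := Gamma.dmvAlgebra V.isStrongUnit.1
    letI := Gamma.dmvAlgebra W.isStrongUnit.1
    { toMVHom := gamma.map (UQVL.forgetToUAG.map f)
      map_δ' := fun n x => Subtype.ext <| f.map_smul' ((n : ℕ) : ℚ)⁻¹ x.1 }

/-! The square of functors commutes definitionally; the content is that `gammaQ` is essentially
surjective, full and faithful.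

For essential surjectivity, the vector lattice is built directly from a DMV-algebra `A`. The
operator `δ 2` is an order isomorphism of `A` onto `[0, 1/2]`, and two halves always add without
truncation (`half_le_compl_half`). So the direct limit of `A` along halving is a cancellative cone.
Elements of the cone differ by disjoint ones (`exists_cone_disjoint`), which makes its group of
differences a lattice-ordered group; `A` is the unit interval of it (`exists_toEnvelope_eq`). Such a
group is torsion-free, and `nsmul_toEnvelope_δ` makes it divisible, hence a `ℚ`-space.

For the rest, every vector, scaled down and translated by half the unit, falls into the unit
interval (`eventually_mem_Icc`). Hence a morphism is determined on the interval. Conversely, an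
interval homomorphism preserves rational convex combinations, so it extends linearly (`extend_eq`).
-/

namespace MVAlgebra

/-! ### Order, untruncated sums and disjointness in MV-algebras -/

section Order

variable {A : Type u} [MVAlgebra A] {a b c x y z : A}

theorem compl_compl'' (x : A) : xᶜᶜ = x := MVAlgebra.compl_compl' x

theorem compl_zero_compl : ((0 : A)ᶜ)ᶜ = 0 := compl_compl'' 0

theorem add_compl_zero (x : A) : x + (0 : A)ᶜ = (0 : A)ᶜ := by
  rw [add_comm, compl_zero_add]

theorem compl_add_self (x : A) : xᶜ + x = (0 : A)ᶜ := by
  have h := luk (0 : A)ᶜ x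
  rwa [compl_zero_compl, zero_add, add_compl_zero] at h

/-- The natural order of an MV-algebra: `x ≤ y` iff `x* ⊕ y = 1`. -/
instance : PartialOrder A where
  le x y := xᶜ + y = (0 : A)ᶜ
  le_refl := compl_add_self
  le_trans x y z hxy hyz := by
    have h1 := luk x y
    have h2 := luk y z
    rw [hxy, compl_zero_compl, zero_add] at h1
    rw [hyz, compl_zero_compl, zero_add, h1] at h2
    change xᶜ + z = (0 : A)ᶜ
    rw [h2, add_comm, add_assoc, add_assoc, add_comm x, compl_add_self, add_compl_zero,
      add_compl_zero]
  le_antisymm x y hxy hyx := by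
    have h1 := luk x y
    rwa [hxy, hyx, compl_zero_compl, zero_add, zero_add, eq_comm] at h1

theorem le_def : x ≤ y ↔ xᶜ + y = (0 : A)ᶜ := Iff.rfl

theorem zero_le' (x : A) : 0 ≤ x := compl_zero_add x

theorem le_compl_zero (x : A) : x ≤ (0 : A)ᶜ := add_compl_zero xᶜ

theorem le_add_left' (x y : A) : x ≤ y + x := by
  rw [le_def, add_left_comm, compl_add_self, add_compl_zero]

theorem compl_add_compl_add (h : x ≤ y) : (yᶜ + x)ᶜ + x = y := by
  rw [luk, le_def.1 h, compl_zero_compl, zero_add]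

theorem add_le_add_left' (h : x ≤ y) (z : A) : x + z ≤ y + z := by
  rw [← compl_add_compl_add h, add_assoc]
  exact le_add_left' _ _

instance : IsOrderedAddMonoid A where
  add_le_add_left _ _ h z := add_le_add_left' h z

theorem compl_le_compl_iff : xᶜ ≤ yᶜ ↔ y ≤ x := by
  rw [le_def, le_def, compl_compl'', add_comm]

theorem le_compl_symm : x ≤ yᶜ ↔ y ≤ xᶜ := by
  rw [le_def, le_def, add_comm]

theorem compl_le_comm : xᶜ ≤ y ↔ yᶜ ≤ x := by
  rw [le_def, le_def, compl_compl'', compl_compl'', add_comm]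

instance : Lattice A where
  sup x y := (xᶜ + y)ᶜ + y
  le_sup_left x y := by
    rw [luk]
    exact le_add_left' _ _
  le_sup_right x y := le_add_left' _ _
  sup_le x y z hx hy := by
    rw [← compl_add_compl_add hy]
    exact add_le_add_left' (compl_le_compl_iff.2
      (add_le_add_left' (compl_le_compl_iff.2 hx) y)) y
  inf x y := ((xᶜᶜ + yᶜ)ᶜ + yᶜ)ᶜ
  inf_le_left x y := by
    rw [compl_le_comm, luk]
    exact le_add_left' _ _
  inf_le_right x y := by
    rw [compl_le_comm]
    exact le_add_left' _ _
  le_inf x y z hy hz := by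
    rw [le_compl_symm, ← compl_add_compl_add (compl_le_compl_iff.2 hz)]
    exact add_le_add_left' (compl_le_compl_iff.2 (add_le_add_left'
      (compl_le_compl_iff.2 (compl_le_compl_iff.2 hy)) _)) _

/-- Truncated subtraction is left adjoint to addition. -/
theorem compl_compl_add_le_iff : (xᶜ + y)ᶜ ≤ z ↔ x ≤ z + y := by
  rw [le_def, le_def, compl_compl'', add_assoc, add_comm y]

theorem inf_add_le (x y z : A) : x ⊓ (y + z) ≤ x ⊓ y + z := by
  rw [← compl_compl_add_le_iff]
  refine le_inf (compl_compl_add_le_iff.2 (inf_le_left.trans ?_))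
    (compl_compl_add_le_iff.2 inf_le_right)
  rw [add_comm]
  exact le_add_left' _ _

/-- The witness is the difference `(yᶜ + x)ᶜ`. Here and below, a condition `z ≤ xᶜ` says that the
sum `z + x` is not truncated. -/
theorem exists_add_of_le (h : x ≤ y) : ∃ z, z ≤ xᶜ ∧ z + x = y :=
  ⟨_, compl_le_compl_iff.2 (le_add_left' x yᶜ), compl_add_compl_add h⟩

/-- A sum may be replaced by one that is defined as a sum without truncation. -/
theorem exists_le_compl_add_eq (x y : A) : ∃ z ≤ x, z ≤ yᶜ ∧ z + y = x + y := by
  refine ⟨((x + y)ᶜ + y)ᶜ, compl_compl_add_le_iff.2 le_rfl,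
    compl_le_compl_iff.2 (le_add_left' _ _), compl_add_compl_add (le_add_left' _ _)⟩

theorem add_compl_add (h : x ≤ yᶜ) : (x + y)ᶜ + x = yᶜ := by
  have h' := compl_add_compl_add h
  rwa [compl_compl'', add_comm y x] at h'

/-- An untruncated sum can be undone: `add_compl_add` recovers `yᶜ` from `x + y` and `x`,
antitonically in `x + y`. -/
theorem le_of_add_le_add (hy : x ≤ yᶜ) (hz : x ≤ zᶜ) (h : x + y ≤ x + z) : y ≤ z := by
  rw [← compl_le_compl_iff, ← add_compl_add hy, ← add_compl_add hz]
  exact add_le_add_left' (compl_le_compl_iff.2 h) x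

/-- Associativity of the partial, untruncated addition. -/
theorem le_compl_add (hxy : x ≤ yᶜ) (h : x + y ≤ zᶜ) : x ≤ (y + z)ᶜ := by
  rw [le_compl_symm, ← add_compl_add (le_compl_symm.1 hxy), add_comm y x, add_comm y z]
  exact add_le_add_left' (le_compl_symm.1 h) y

/-- Two elements differ by disjoint elements. -/
theorem exists_disjoint (x y : A) :
    ∃ m p q, p ≤ mᶜ ∧ q ≤ mᶜ ∧ p + m = x ∧ q + m = y ∧ p ⊓ q = 0 := by
  obtain ⟨p, hp, hpx⟩ := exists_add_of_le (inf_le_left (a := x) (b := y))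
  obtain ⟨q, hq, hqy⟩ := exists_add_of_le (inf_le_right (a := x) (b := y))
  refine ⟨x ⊓ y, p, q, hp, hq, hpx, hqy, le_antisymm ?_ (zero_le' _)⟩
  refine le_of_add_le_add (x := x ⊓ y) (le_compl_symm.1 (inf_le_left.trans hp))
    (le_compl_zero _) ?_
  rw [add_zero, add_comm]
  exact le_inf ((add_le_add_left' inf_le_left _).trans hpx.le)
    ((add_le_add_left' inf_le_right _).trans hqy.le)

theorem le_of_le_add_of_inf_eq_zero (h : x ≤ z + y) (hxy : x ⊓ y = 0) : x ≤ z := by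
  have h' := (le_inf le_rfl (h.trans_eq (add_comm z y))).trans (inf_add_le x y z)
  rwa [hxy, zero_add] at h'

theorem add_self_le_compl_add_self (hx : x ≤ yᶜ) (h : x + y ≤ (x + y)ᶜ) :
    y + y ≤ (x + x)ᶜ := by
  have h1 : y ≤ (x + (x + y))ᶜ := le_compl_add (le_compl_symm.1 hx) (by rwa [add_comm y])
  rw [← add_assoc] at h1
  refine le_compl_symm.1 (le_compl_add ?_ (le_compl_symm.1 h1))
  refine le_compl_symm.1 (h1.trans (compl_le_compl_iff.2 ?_))
  rw [add_comm (x + x)]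
  exact le_add_left' _ _

/-- Cancel the common part of `x` and `y`. The disjoint remainders satisfy `p ≤ q + q`, which forces
`p ≤ q`. This makes halves unique and halving an order embedding. -/
theorem le_of_add_self_le_add_self (hx : x ≤ xᶜ) (hy : y ≤ yᶜ) (h : x + x ≤ y + y) : x ≤ y := by
  obtain ⟨m, p, q, hp, hq, rfl, rfl, hpq⟩ := exists_disjoint x y
  have h1 : p + p ≤ q + q := by
    refine le_of_add_le_add (add_self_le_compl_add_self hp hx)
      (add_self_le_compl_add_self hq hy) ?_
    rwa [add_add_add_comm, add_add_add_comm q, add_comm (p + p), add_comm (q + q)] at h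
  have h2 : p ≤ q := le_of_le_add_of_inf_eq_zero ((le_add_left' p p).trans h1) hpq
  exact add_le_add_left' h2 m

end Order

end MVAlgebra

/-! ### Halving in a DMV-algebra -/

namespace DMVAlgebra

open MVAlgebra

section Half

variable {A : Type u} [DMVAlgebra A] {a b c : A}

/-- Halving. -/
def half (a : A) : A := δ 2 a

theorem half_add_half (a : A) : half a + half a = a := by
  have h := nsmul_δ 2 a
  rwa [PNat.val_ofNat, two_nsmul] at h

theorem half_le_compl_self (a : A) : half a ≤ (half a)ᶜ := by
  have h := odot_δ 2 a
  change odot (half a) (1 • half a) = 0 at h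
  rw [one_nsmul, odot] at h
  rw [le_def, ← compl_compl'' ((half a)ᶜ + (half a)ᶜ), h]

theorem half_le_half_iff : half a ≤ half b ↔ a ≤ b := by
  refine ⟨fun h => ?_, fun h => ?_⟩
  · rw [← half_add_half a, ← half_add_half b]
    exact add_le_add h h
  · refine le_of_add_self_le_add_self (half_le_compl_self a) (half_le_compl_self b) ?_
    rwa [half_add_half, half_add_half]

/-- Every half lies below the half of `1`, which adds to itself without truncation. -/
theorem half_le_compl_half (a b : A) : half a ≤ (half b)ᶜ :=
  (half_le_half_iff.2 (le_compl_zero a)).trans ((half_le_compl_self _).trans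
    (compl_le_compl_iff.2 (half_le_half_iff.2 (le_compl_zero b))))

theorem half_eq_of_add_self (h : a ≤ aᶜ) (hb : a + a = b) : half b = a := by
  refine le_antisymm (le_of_add_self_le_add_self (half_le_compl_self b) h ?_)
    (le_of_add_self_le_add_self h (half_le_compl_self b) ?_) <;> rw [half_add_half, hb]

theorem half_zero : half (0 : A) = 0 :=
  half_eq_of_add_self (zero_le' _) (add_zero 0)

theorem half_add (h : a ≤ bᶜ) : half (a + b) = half a + half b := by
  refine half_eq_of_add_self ?_ ?_
  · have h1 : half a ≤ (half a + b)ᶜ :=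
      le_compl_add (half_le_compl_half a a) (by rwa [half_add_half])
    have h2 : half b ≤ (half b + half a)ᶜ := by
      refine le_compl_add (half_le_compl_half b b) ?_
      rw [half_add_half, le_compl_symm]
      refine le_trans ?_ h
      conv_rhs => rw [← half_add_half a]
      exact le_add_left' _ _
    rw [add_comm (half b), le_compl_symm] at h2
    have h3 := le_compl_add h2 (z := half a) (by
      rwa [add_assoc, half_add_half, le_compl_symm])
    rwa [add_comm (half b)] at h3
  · rw [add_add_add_comm, half_add_half, half_add_half]

theorem exists_half_eq (h : a ≤ half b) : ∃ c ≤ b, half c = a := by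
  have h1 : a ≤ aᶜ := h.trans ((half_le_compl_self b).trans (compl_le_compl_iff.2 h))
  refine ⟨a + a, ?_, half_eq_of_add_self h1 rfl⟩
  rw [← half_add_half b]
  exact add_le_add h h

theorem half_iterate_le_iff (n : ℕ) : half^[n] a ≤ half^[n] b ↔ a ≤ b := by
  induction n with
  | zero => rfl
  | succ n ih => rw [Function.iterate_succ_apply', Function.iterate_succ_apply', half_le_half_iff, ih]

theorem half_iterate_zero (n : ℕ) : half^[n] (0 : A) = 0 :=
  Function.iterate_fixed half_zero n

theorem half_iterate_add (h : a ≤ bᶜ) (n : ℕ) : half^[n] (a + b) = half^[n] a + half^[n] b := by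
  induction n with
  | zero => rfl
  | succ n ih =>
    rw [Function.iterate_succ_apply', ih]
    cases n with
    | zero => exact half_add h
    | succ n =>
      simp only [Function.iterate_succ_apply']
      exact half_add (half_le_compl_half _ _)

end Half

end DMVAlgebra

/-! ### The positive cone as a direct limit along halving -/

namespace DMVAlgebra

open MVAlgebra Filter

section Cone

variable {A : Type u} [DMVAlgebra A] {a b c : A}

/-- The germ at infinity of `n ↦ 2 ^ (k - n) a`, standing for the multiple `2 ^ k a`. -/
def scaleGerm (k : ℕ) (a : A) : Germ (atTop : Filter ℕ) A :=
  -- The subtraction is truncated for `n < k`, which a germ at infinity does not see.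
  ((fun n => half^[n - k] a : ℕ → A) : Germ atTop A)

theorem scaleGerm_le_iff {k : ℕ} : scaleGerm k a ≤ scaleGerm k b ↔ a ≤ b := by
  refine Germ.coe_le.trans ⟨fun h => ?_, fun h => .of_forall fun n => (half_iterate_le_iff _).2 h⟩
  obtain ⟨n, hn⟩ := h.exists
  exact (half_iterate_le_iff _).1 hn

theorem scaleGerm_succ_half (k : ℕ) (a : A) : scaleGerm (k + 1) (half a) = scaleGerm k a := by
  refine Germ.coe_eq.2 ?_
  filter_upwards [eventually_ge_atTop (k + 1)] with n hn
  rw [← Function.iterate_succ_apply]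
  congr 1
  omega

theorem scaleGerm_add (k : ℕ) (h : a ≤ bᶜ) :
    scaleGerm k (a + b) = scaleGerm k a + scaleGerm k b :=
  Germ.coe_eq.2 (.of_forall fun n => half_iterate_add h (n - k))

/-- Finitely many elements can thus be represented by halves at one common level, where their sums
are computed in `A` without truncation. -/
theorem eventually_scaleGerm_half (k : ℕ) (a : A) :
    ∀ᶠ n in atTop, ∃ b, scaleGerm n (half b) = scaleGerm k a := by
  filter_upwards [eventually_ge_atTop (k + 1)] with n hn
  induction n, hn using Nat.le_induction with
  | base => exact ⟨a, scaleGerm_succ_half k a⟩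
  | succ n _ ih =>
    obtain ⟨b, hb⟩ := ih
    exact ⟨half b, (scaleGerm_succ_half n _).trans hb⟩

variable (A) in
/-- The positive cone of the enveloping vector lattice of `A`. -/
def cone : AddSubmonoid (Germ (atTop : Filter ℕ) A) where
  carrier := {x | ∃ k a, scaleGerm k a = x}
  zero_mem' := ⟨0, 0, Germ.coe_eq.2 (.of_forall fun n => half_iterate_zero n)⟩
  add_mem' := by
    rintro _ _ ⟨k, a, rfl⟩ ⟨l, b, rfl⟩
    obtain ⟨n, ⟨a', ha⟩, b', hb⟩ :=
      ((eventually_scaleGerm_half k a).and (eventually_scaleGerm_half l b)).exists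
    exact ⟨n, half a' + half b', by rw [← ha, ← hb, scaleGerm_add n (half_le_compl_half _ _)]⟩

/-- The element `2 ^ k a` of the cone. -/
def scale (k : ℕ) (a : A) : cone A := ⟨scaleGerm k a, k, a, rfl⟩

theorem scale_le_iff {k : ℕ} : scale k a ≤ scale k b ↔ a ≤ b := scaleGerm_le_iff

theorem scale_add (k : ℕ) (h : a ≤ bᶜ) : scale k (a + b) = scale k a + scale k b :=
  Subtype.ext (scaleGerm_add k h)

theorem scale_zero (k : ℕ) : scale k (0 : A) = 0 :=
  Subtype.ext (Germ.coe_eq.2 (.of_forall fun n => half_iterate_zero (n - k)))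

theorem scale_succ_half (k : ℕ) (a : A) : scale (k + 1) (half a) = scale k a :=
  Subtype.ext (scaleGerm_succ_half k a)

theorem scale_half_add_half (k : ℕ) (a b : A) :
    scale k (half a + half b) = scale k (half a) + scale k (half b) :=
  scale_add k (half_le_compl_half a b)

theorem eventually_scale_half (x : cone A) : ∀ᶠ n in atTop, ∃ a, scale n (half a) = x := by
  obtain ⟨_, k, a, rfl⟩ := x
  filter_upwards [eventually_scaleGerm_half k a] with n ⟨b, hb⟩
  exact ⟨b, Subtype.ext hb⟩

theorem scale_eq_nsmul (k : ℕ) (a : A) : scale k a = 2 ^ k • scale 0 a := by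
  induction k with
  | zero => rw [pow_zero, one_smul]
  | succ k ih =>
    conv_lhs => rw [← half_add_half a]
    rw [scale_half_add_half, scale_succ_half, ih, ← two_nsmul, smul_smul, pow_succ']

instance : IsOrderedCancelAddMonoid (cone A) where
  add_le_add_left a b h c := by exact add_le_add_left h c
  le_of_add_le_add_left x y z h := by
    obtain ⟨n, ⟨⟨a, rfl⟩, b, rfl⟩, c, rfl⟩ := (((eventually_scale_half x).and
      (eventually_scale_half y)).and (eventually_scale_half z)).exists
    rw [← scale_half_add_half, ← scale_half_add_half, scale_le_iff] at h
    exact scale_le_iff.2 (le_of_add_le_add (half_le_compl_half _ _) (half_le_compl_half _ _) h)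

theorem cone_nonneg (x : cone A) : 0 ≤ x := by
  obtain ⟨n, a, rfl⟩ := (eventually_scale_half x).exists
  rw [← scale_zero n, scale_le_iff]
  exact zero_le' _

theorem scale_compl_zero_mono {k l : ℕ} (h : k ≤ l) :
    scale k (0 : A)ᶜ ≤ scale l (0 : A)ᶜ := by
  rw [scale_eq_nsmul k, scale_eq_nsmul l]
  exact nsmul_le_nsmul_left (cone_nonneg _) (Nat.pow_le_pow_right two_pos h)

/-- Descent on the level: above level `k`, the bound puts the representative below the half of `1`,
so it is itself a half and drops one level. -/
theorem exists_scale_eq_of_le {k : ℕ} {x : cone A} (h : x ≤ scale k (0 : A)ᶜ) :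
    ∃ a, scale k a = x := by
  obtain ⟨n, ⟨a, rfl⟩, hn⟩ := ((eventually_scale_half x).and (eventually_ge_atTop k)).exists
  generalize half a = b at h
  induction n, hn using Nat.le_induction generalizing b with
  | base => exact ⟨b, rfl⟩
  | succ n hn ih =>
    have hb : b ≤ half (0 : A)ᶜ := by
      rw [← scale_le_iff (k := n + 1), scale_succ_half]
      exact h.trans (scale_compl_zero_mono hn)
    obtain ⟨c, -, rfl⟩ := exists_half_eq hb
    rw [scale_succ_half] at h ⊢
    exact ih c h

/-- Links the truncated sum of `A` with the true sum of the cone. After halving, the two agree;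
conversely, `a` is shrunk until its sum with `b` is untruncated. -/
theorem scale_zero_add_le_iff :
    scale 0 c ≤ scale 0 a + scale 0 b ↔ c ≤ a + b := by
  refine ⟨fun h => ?_, fun h => ?_⟩
  · rw [← scale_succ_half, ← scale_succ_half 0 a, ← scale_succ_half 0 b,
      ← scale_half_add_half, scale_le_iff] at h
    rw [← half_add_half a, ← half_add_half b, ← half_add_half c, add_add_add_comm]
    exact add_le_add h h
  · obtain ⟨d, hda, hdb, hd⟩ := exists_le_compl_add_eq a b
    refine (scale_le_iff.2 h).trans ?_
    rw [← hd, scale_add 0 hdb]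
    exact add_le_add_left (scale_le_iff.2 hda) _

/-- Two elements of the cone differ by disjoint elements of the cone. -/
theorem exists_cone_disjoint (x y : cone A) : ∃ m p q : cone A, p + m = x ∧ q + m = y ∧
    ∀ z : cone A, p ≤ z + q → p ≤ z := by
  obtain ⟨n, ⟨a, rfl⟩, b, rfl⟩ :=
    ((eventually_scale_half x).and (eventually_scale_half y)).exists
  obtain ⟨m, p, q, hp, hq, hpa, hqb, hpq⟩ := exists_disjoint (half a) (half b)
  refine ⟨scale n m, scale n p, scale n q, by rw [← scale_add n hp, hpa],
    by rw [← scale_add n hq, hqb], fun z hz => ?_⟩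
  -- Disjointness must hold in the whole cone, since `z` may only exist at a finer level; common
  -- lower bounds descend to level `n`.
  have hdis : ∀ t : cone A, t ≤ scale n p → t ≤ scale n q → t = 0 := by
    intro t htp htq
    obtain ⟨c, rfl⟩ := exists_scale_eq_of_le (htp.trans (scale_le_iff.2 (le_compl_zero p)))
    have hc : c ≤ p ⊓ q := le_inf (scale_le_iff.1 htp) (scale_le_iff.1 htq)
    rw [hpq] at hc
    rw [le_antisymm hc (zero_le' c), scale_zero]
  obtain ⟨l, ⟨⟨p', hp'⟩, q', hq'⟩, z', rfl⟩ := (((eventually_scale_half (scale n p)).and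
    (eventually_scale_half (scale n q))).and (eventually_scale_half z)).exists
  rw [← hp', ← hq'] at hdis hz
  rw [← hp']
  rw [← scale_half_add_half, scale_le_iff] at hz
  refine scale_le_iff.2 (le_of_le_add_of_inf_eq_zero hz (le_antisymm ?_ (zero_le' _)))
  rw [← scale_le_iff (k := l), scale_zero]
  exact (hdis _ (scale_le_iff.2 inf_le_left) (scale_le_iff.2 inf_le_right)).le

theorem exists_add_eq_of_cone_le {x y : cone A} (h : x ≤ y) : ∃ z, z + x = y := by
  obtain ⟨n, ⟨a, rfl⟩, b, rfl⟩ :=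
    ((eventually_scale_half x).and (eventually_scale_half y)).exists
  obtain ⟨c, hc, hcb⟩ := exists_add_of_le (scale_le_iff.1 h)
  exact ⟨scale n c, by rw [← scale_add n hc, hcb]⟩

end Cone

end DMVAlgebra

/-! ### Disjointness and multiples in lattice-ordered groups -/

section LatticeOrderedGroup

variable {G : Type u} [AddCommGroup G] [Lattice G] [IsOrderedAddMonoid G] {a b e : G}

theorem inf_nsmul_nonpos (hb : 0 ≤ b) (h : a ⊓ b ≤ 0) (n : ℕ) : a ⊓ n • b ≤ 0 := by
  induction n with
  | zero => rw [zero_smul]; exact inf_le_right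
  | succ n ih =>
    refine (le_inf inf_le_left ?_).trans h
    have h1 : a ⊓ (n + 1) • b - b ≤ a ⊓ n • b :=
      le_inf ((sub_le_self _ hb).trans inf_le_left)
        (sub_le_iff_le_add.2 (inf_le_right.trans (succ_nsmul b n).le))
    simpa using h1.trans ih

/-- The negative part is dominated by `n • a⁺` yet disjoint from it, so it vanishes. -/
theorem nonneg_of_nsmul_nonneg {n : ℕ} (hn : n ≠ 0) (h : 0 ≤ n • a) : 0 ≤ a := by
  have h1 : n • a⁻ ≤ n • a⁺ := by
    rw [← sub_nonneg, ← nsmul_sub, posPart_sub_negPart]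
    exact h
  have h2 := inf_nsmul_nonpos (posPart_nonneg a)
    (by rw [inf_comm, posPart_inf_negPart_eq_zero]) n
  rw [inf_eq_left.2 ((le_self_nsmul (negPart_nonneg a) hn).trans h1)] at h2
  exact negPart_nonpos.1 h2

theorem nsmul_le_nsmul_iff_of_ne_zero {n : ℕ} (hn : n ≠ 0) : n • a ≤ n • b ↔ a ≤ b := by
  refine ⟨fun h => ?_, fun h => nsmul_le_nsmul_right h n⟩
  rw [← sub_nonneg]
  refine nonneg_of_nsmul_nonneg hn ?_
  rwa [nsmul_sub, sub_nonneg]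

variable (G) in
theorem isAddTorsionFree_of_lattice : IsAddTorsionFree G where
  nsmul_right_injective _ hn _ _ h :=
    le_antisymm ((nsmul_le_nsmul_iff_of_ne_zero hn).1 h.le)
      ((nsmul_le_nsmul_iff_of_ne_zero hn).1 h.ge)

/-- The hypothesis makes `a`, hence `n • a`, disjoint from the positive part of `n • a - e`, which
lies below `n • a` and so is zero. -/
theorem nsmul_le_of_inf_le (ha : 0 ≤ a) (he : 0 ≤ e) {n : ℕ} (h : (a + e) ⊓ n • a ≤ e) :
    n • a ≤ e := by
  let := AddCommGroup.toDistribLattice G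
  have h1 : a ⊓ ((n • a - e) ⊔ 0) ≤ 0 := by
    rw [inf_sup_left]
    refine sup_le ?_ inf_le_right
    rw [← add_le_add_iff_right e, inf_add, sub_add_cancel, zero_add]
    exact h
  have h2 := inf_nsmul_nonpos ha (by rwa [inf_comm]) n
  rw [inf_eq_left.2 (sup_le (sub_le_self _ he) (nsmul_nonneg ha n))] at h2
  exact sub_nonpos.1 (le_sup_left.trans h2)

end LatticeOrderedGroup

/-- A divisible torsion-free abelian group is a rational vector space. -/
noncomputable abbrev ratModuleOfDivisible (G : Type u) [AddCommGroup G] [IsAddTorsionFree G]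
    (h : ∀ (n : ℕ+) (x : G), ∃ y, (n : ℕ) • y = x) : Module ℚ G :=
  let f : G ≃+ DivisibleHull G := AddEquiv.ofBijective (DivisibleHull.coeAddMonoidHom G)
    ⟨DivisibleHull.coe_injective, fun x => by
      induction x with
      | mk x n =>
        obtain ⟨y, rfl⟩ := h n x
        exact ⟨y, DivisibleHull.mk_eq_mk.2 ⟨1, by simp⟩⟩⟩
  letI : SMul ℚ G := ⟨fun q x => f.symm (q • f x)⟩
  Function.Injective.module ℚ f.toAddMonoidHom f.injective fun q x => f.apply_symm_apply _

/-! ### Order and lattice structure on groups of differences -/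

section Grothendieck

open Algebra

variable {M : Type u} [AddCommMonoid M]

theorem grothendieck_of_le_of [PartialOrder M] [IsOrderedCancelAddMonoid M] {a b : M} :
    GrothendieckAddGroup.of a ≤ GrothendieckAddGroup.of b ↔ a ≤ b := by
  change AddLocalization.mk a 0 ≤ AddLocalization.mk b 0 ↔ a ≤ b
  rw [AddLocalization.mk_le_mk]
  simp

theorem exists_of_sub_of (x : GrothendieckAddGroup M) :
    ∃ a b, GrothendieckAddGroup.of a - GrothendieckAddGroup.of b = x := by
  induction x using AddLocalization.ind with
  | H y =>
    obtain ⟨a, b⟩ := y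
    refine ⟨a, b, ?_⟩
    change AddLocalization.mk a 0 - AddLocalization.mk b.1 0 = _
    rw [GrothendieckAddGroup.mk_sub_mk]
    simp

/-- An ordered abelian group is a lattice as soon as every element has a positive part. -/
noncomputable abbrev latticeOfPosPart (G : Type u) [AddCommGroup G] [PartialOrder G]
    [IsOrderedAddMonoid G] (h : ∀ x : G, ∃ p, IsLUB {x, 0} p) : Lattice G :=
  have hsup : ∀ x y : G, ∃ z, IsLUB {x, y} z := fun x y => by
    obtain ⟨p, hp⟩ := h (x - y)
    refine ⟨p + y, ?_⟩
    simp only [isLUB_iff_le_iff, mem_upperBounds, Set.mem_insert_iff, Set.mem_singleton_iff,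
      forall_eq_or_imp, forall_eq] at hp ⊢
    intro b
    rw [← le_sub_iff_add_le, hp, sub_le_sub_iff_right, sub_nonneg]
  have hle : ∀ x y z : G, Classical.choose (hsup x y) ≤ z ↔ x ≤ z ∧ y ≤ z := fun x y z => by
    rw [isLUB_le_iff (Classical.choose_spec (hsup x y))]
    simp
  { (inferInstance : PartialOrder G) with
    sup := fun x y => Classical.choose (hsup x y)
    le_sup_left := fun x y => ((hle x y _).1 le_rfl).1
    le_sup_right := fun x y => ((hle x y _).1 le_rfl).2
    sup_le := fun x y z hx hy => (hle x y z).2 ⟨hx, hy⟩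
    inf := fun x y => -Classical.choose (hsup (-x) (-y))
    inf_le_left := fun x y => neg_le.1 ((hle _ _ _).1 le_rfl).1
    inf_le_right := fun x y => neg_le.1 ((hle _ _ _).1 le_rfl).2
    le_inf := fun x y z hy hz => le_neg.1 ((hle _ _ _).2 ⟨neg_le_neg hy, neg_le_neg hz⟩) }

end Grothendieck

/-! ### The enveloping lattice-ordered group and its unit interval -/

namespace DMVAlgebra

open MVAlgebra Algebra

section Envelope

variable (A : Type u) [DMVAlgebra A]

/-- The enveloping vector lattice of a DMV-algebra. -/
abbrev Envelope : Type u := GrothendieckAddGroup (cone A)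

/-- Write `x = p - q` with `p`, `q` disjoint in the cone; then `p` is the positive part. A competing
bound is nonnegative, hence in the cone, where disjointness applies. -/
theorem Envelope.exists_isLUB (x : Envelope A) : ∃ p, IsLUB {x, 0} p := by
  obtain ⟨a, b, rfl⟩ := exists_of_sub_of x
  obtain ⟨m, p, q, rfl, rfl, hpq⟩ := exists_cone_disjoint a b
  rw [map_add, map_add, add_sub_add_right_eq_sub]
  refine ⟨GrothendieckAddGroup.of p, ?_, ?_⟩
  · simp only [mem_upperBounds, Set.mem_insert_iff, Set.mem_singleton_iff, forall_eq_or_imp,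
      forall_eq]
    constructor
    · rw [sub_le_iff_le_add, ← map_add, grothendieck_of_le_of]
      exact le_add_of_nonneg_right (cone_nonneg q)
    · rw [← map_zero GrothendieckAddGroup.of, grothendieck_of_le_of]
      exact cone_nonneg p
  · intro z hz
    simp only [mem_upperBounds, Set.mem_insert_iff, Set.mem_singleton_iff, forall_eq_or_imp,
      forall_eq] at hz
    obtain ⟨hz1, hz0⟩ := hz
    obtain ⟨c, d, rfl⟩ := exists_of_sub_of z
    rw [sub_nonneg, grothendieck_of_le_of] at hz0
    obtain ⟨e, rfl⟩ := exists_add_eq_of_cone_le hz0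
    rw [map_add, add_sub_cancel_right] at hz1 ⊢
    rw [sub_le_iff_le_add, ← map_add, grothendieck_of_le_of] at hz1
    exact grothendieck_of_le_of.2 (hpq e hz1)

noncomputable instance : Lattice (Envelope A) :=
  latticeOfPosPart (Envelope A) (Envelope.exists_isLUB A)

instance : IsOrderedAddMonoid (Envelope A) where
  add_le_add_left _ _ h c := add_le_add_left (α := Envelope A) h c

instance : IsAddTorsionFree (Envelope A) := isAddTorsionFree_of_lattice (Envelope A)

variable {A}

/-- The embedding of a DMV-algebra into its enveloping vector lattice. -/
noncomputable def toEnvelope (a : A) : Envelope A := GrothendieckAddGroup.of (scale 0 a)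

theorem toEnvelope_le_iff {a b : A} : toEnvelope a ≤ toEnvelope b ↔ a ≤ b :=
  grothendieck_of_le_of.trans scale_le_iff

theorem toEnvelope_zero : toEnvelope (0 : A) = 0 := by
  rw [toEnvelope, scale_zero, map_zero]

theorem toEnvelope_add {a b : A} (h : a ≤ bᶜ) :
    toEnvelope (a + b) = toEnvelope a + toEnvelope b := by
  rw [toEnvelope, scale_add 0 h, map_add]; rfl

theorem toEnvelope_le_add_iff {a b c : A} :
    toEnvelope c ≤ toEnvelope a + toEnvelope b ↔ c ≤ a + b := by
  rw [toEnvelope, toEnvelope, toEnvelope, ← map_add]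
  exact grothendieck_of_le_of.trans scale_zero_add_le_iff

theorem exists_toEnvelope_eq {x : Envelope A} (h0 : 0 ≤ x) (h1 : x ≤ toEnvelope (0 : A)ᶜ) :
    ∃ a, toEnvelope a = x := by
  obtain ⟨c, d, rfl⟩ := exists_of_sub_of x
  rw [sub_nonneg, grothendieck_of_le_of] at h0
  obtain ⟨e, rfl⟩ := exists_add_eq_of_cone_le h0
  rw [map_add, add_sub_cancel_right] at h1 ⊢
  obtain ⟨a, rfl⟩ := exists_scale_eq_of_le (grothendieck_of_le_of.1 h1)
  exact ⟨a, rfl⟩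

theorem exists_nsmul_toEnvelope_sub (x : Envelope A) :
    ∃ (n : ℕ) (a b : A), n • toEnvelope a - n • toEnvelope b = x := by
  obtain ⟨c, d, rfl⟩ := exists_of_sub_of x
  obtain ⟨n, ⟨a, rfl⟩, b, rfl⟩ :=
    ((eventually_scale_half c).and (eventually_scale_half d)).exists
  refine ⟨2 ^ n, half a, half b, ?_⟩
  rw [scale_eq_nsmul n, scale_eq_nsmul n, map_nsmul, map_nsmul]
  rfl

theorem toEnvelope_nonneg (a : A) : 0 ≤ toEnvelope a := by
  rw [← toEnvelope_zero, toEnvelope_le_iff]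
  exact zero_le' a

theorem toEnvelope_le (a : A) : toEnvelope a ≤ toEnvelope (0 : A)ᶜ :=
  toEnvelope_le_iff.2 (le_compl_zero a)

theorem toEnvelope_compl (a : A) : toEnvelope aᶜ = toEnvelope (0 : A)ᶜ - toEnvelope a := by
  rw [eq_sub_iff_add_eq, ← toEnvelope_add le_rfl, compl_add_self]

theorem toEnvelope_add_eq_inf (a b : A) :
    toEnvelope (a + b) = toEnvelope (0 : A)ᶜ ⊓ (toEnvelope a + toEnvelope b) := by
  refine le_antisymm (le_inf (toEnvelope_le _) (toEnvelope_le_add_iff.2 le_rfl)) ?_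
  -- The infimum lies in the unit interval, so it comes from `A` and can be compared with `a + b`
  -- there.
  obtain ⟨c, hc⟩ := exists_toEnvelope_eq (x := toEnvelope (0 : A)ᶜ ⊓ (toEnvelope a + toEnvelope b))
    (le_inf (toEnvelope_nonneg _) (add_nonneg (toEnvelope_nonneg a) (toEnvelope_nonneg b)))
    inf_le_left
  rw [← hc, toEnvelope_le_iff, ← toEnvelope_le_add_iff, hc]
  exact inf_le_right

theorem isStrongUnit_toEnvelope : IsStrongUnit (toEnvelope (0 : A)ᶜ) := by
  refine ⟨toEnvelope_nonneg _, fun x => ?_⟩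
  obtain ⟨n, a, b, rfl⟩ := exists_nsmul_toEnvelope_sub x
  refine ⟨n, abs_le'.2 ⟨?_, ?_⟩⟩
  · exact (sub_le_self _ (nsmul_nonneg (toEnvelope_nonneg b) n)).trans
      (nsmul_le_nsmul_right (toEnvelope_le a) n)
  · rw [neg_sub]
    exact (sub_le_self _ (nsmul_nonneg (toEnvelope_nonneg a) n)).trans
      (nsmul_le_nsmul_right (toEnvelope_le b) n)

end Envelope

end DMVAlgebra

theorem isOrderedModule_rat (G : Type u) [AddCommGroup G] [Lattice G] [IsOrderedAddMonoid G]
    [Module ℚ G] : IsOrderedModule ℚ G := by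
  have h : ∀ (q : ℚ) (x : G), 0 ≤ q → 0 ≤ x → 0 ≤ q • x := fun q x hq hx => by
    refine nonneg_of_nsmul_nonneg q.den_ne_zero ?_
    have hn : q.den • q • x = q.num.toNat • x := by
      rw [← Nat.cast_smul_eq_nsmul ℚ, ← Nat.cast_smul_eq_nsmul ℚ, smul_smul, Rat.den_mul_eq_num]
      congr 1
      rw [← Int.cast_natCast, Int.toNat_of_nonneg (Rat.num_nonneg.2 hq)]
    rw [hn]
    exact nsmul_nonneg hx _
  exact
    { smul_le_smul_of_nonneg_left := fun q hq x y hxy => by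
        rw [← sub_nonneg, ← smul_sub]
        exact h _ _ hq (sub_nonneg.2 hxy)
      smul_le_smul_of_nonneg_right := fun x hx p q hpq => by
        rw [← sub_nonneg, ← sub_smul]
        exact h _ _ (sub_nonneg.2 hpq) hx }

/-! ### Division by positive integers in the envelope -/

namespace DMVAlgebra

open MVAlgebra

section Envelope

variable {A : Type u} [DMVAlgebra A]

theorem toEnvelope_nsmul (n : ℕ) (a : A) :
    toEnvelope (n • a) = toEnvelope (0 : A)ᶜ ⊓ n • toEnvelope a := by
  induction n with
  | zero => rw [zero_smul, zero_smul, toEnvelope_zero, inf_eq_right.2 (toEnvelope_nonneg _)]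
  | succ n ih =>
    rw [succ_nsmul, toEnvelope_add_eq_inf, ih, Gamma.inf_trunc_add _ (toEnvelope_nonneg a),
      succ_nsmul]

theorem δ_le_compl (n : ℕ+) (a : A) : δ n a ≤ (((n : ℕ) - 1) • δ n a)ᶜ := by
  have h := odot_δ n a
  rw [odot] at h
  rw [le_def, ← compl_compl'' ((δ n a)ᶜ + _), h]

/-- The axiom `nsmul_δ` gives this only up to truncation at the unit. The axiom `odot_δ`, through
`nsmul_le_of_inf_le`, shows that nothing is truncated. -/
theorem nsmul_toEnvelope_δ (n : ℕ+) (a : A) : (n : ℕ) • toEnvelope (δ n a) = toEnvelope a := by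
  have h1 := toEnvelope_nsmul (n : ℕ) (δ n a)
  have h2 := toEnvelope_le_iff.2 (δ_le_compl n a)
  rw [nsmul_δ] at h1
  rw [toEnvelope_compl, toEnvelope_nsmul, le_sub_iff_add_le, add_inf, ← succ_nsmul',
    Nat.sub_add_cancel n.pos] at h2
  rw [h1, inf_eq_right.2 (nsmul_le_of_inf_le (toEnvelope_nonneg _) (toEnvelope_nonneg _) h2)]

noncomputable instance : Module ℚ (Envelope A) :=
  ratModuleOfDivisible (Envelope A) fun n x => by
    obtain ⟨m, a, b, rfl⟩ := exists_nsmul_toEnvelope_sub x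
    refine ⟨m • toEnvelope (δ n a) - m • toEnvelope (δ n b), ?_⟩
    rw [nsmul_sub, smul_comm, smul_comm _ m, nsmul_toEnvelope_δ, nsmul_toEnvelope_δ]

instance : IsOrderedModule ℚ (Envelope A) := isOrderedModule_rat _

variable (A) in
/-- The enveloping vector lattice, with the image of `1` as strong unit. -/
noncomputable def envelope : UQVL.{u} where
  carrier := Envelope A
  unit := toEnvelope (0 : A)ᶜ
  isStrongUnit := isStrongUnit_toEnvelope

end Envelope

end DMVAlgebra

/-- Two morphisms of DMV-algebras are equal if they agree as functions. -/
theorem DMVCat.hom_ext {A B : DMVCat.{u}} {f g : A ⟶ B} (h : ∀ x, f.toFun x = g.toFun x) :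
    f = g := by
  obtain ⟨⟨f, _⟩, _⟩ := f
  obtain ⟨⟨g, _⟩, _⟩ := g
  obtain rfl : f = g := DFunLike.ext _ _ h
  rfl

/-- A bijective homomorphism of DMV-algebras is an isomorphism. -/
noncomputable def DMVCat.isoOfBijective {A B : DMVCat.{u}} (f : DMVHom A.carrier B.carrier)
    (hf : Function.Bijective f.toFun) : A ≅ B :=
  let e := Equiv.ofBijective f.toFun hf
  have he : ∀ y, f.toFun (e.symm y) = y := e.apply_symm_apply
  { hom := f
    inv :=
      { toFun := e.symm
        map_zero' := hf.1 ((he _).trans f.map_zero'.symm)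
        map_add' := fun x y => hf.1 <| by
          rw [he]
          exact ((f.map_add' _ _).trans (congrArg₂ _ (he x) (he y))).symm
        map_compl' := fun x => hf.1 <| by
          rw [he]
          exact ((f.map_compl' _).trans (congrArg _ (he x))).symm
        map_δ' := fun n x => hf.1 <| by
          rw [he]
          exact ((f.map_δ' n _).trans (congrArg _ (he x))).symm }
    hom_inv_id := DMVCat.hom_ext e.symm_apply_apply
    inv_hom_id := DMVCat.hom_ext he }

/-! ### Essential surjectivity -/

open DMVAlgebra in
theorem gammaQ_essSurj : gammaQ.{u}.EssSurj where
  mem_essImage A := by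
    refine ⟨envelope A.carrier, ⟨(DMVCat.isoOfBijective (B := gammaQ.obj (envelope A.carrier))
      { toFun := fun a => ⟨toEnvelope a, toEnvelope_nonneg a, toEnvelope_le a⟩
        map_zero' := Subtype.ext toEnvelope_zero
        map_add' := fun a b => Subtype.ext (toEnvelope_add_eq_inf a b)
        map_compl' := fun a => Subtype.ext (toEnvelope_compl a)
        map_δ' := fun n a => Subtype.ext ?_ } ⟨fun a b h => ?_, fun x => ?_⟩).symm⟩⟩
    · change toEnvelope (δ n a) = ((n : ℕ) : ℚ)⁻¹ • toEnvelope a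
      rw [← nsmul_toEnvelope_δ n a, ← Nat.cast_smul_eq_nsmul ℚ,
        inv_smul_smul₀ (Nat.cast_ne_zero.2 n.ne_zero)]
    · have h' : toEnvelope a = toEnvelope b := congrArg Subtype.val h
      exact le_antisymm (toEnvelope_le_iff.1 h'.le) (toEnvelope_le_iff.1 h'.ge)
    · obtain ⟨a, ha⟩ := exists_toEnvelope_eq x.2.1 x.2.2
      exact ⟨a, Subtype.ext ha⟩

/-! ### Extending homomorphisms from the unit interval -/

namespace UQVL

/-- Two morphisms are equal if they agree as functions. -/
theorem hom_ext {V W : UQVL.{u}} {f g : V ⟶ W} (h : ∀ x, f.toFun x = g.toFun x) : f = g := by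
  obtain ⟨f, _, _, _⟩ := f
  obtain ⟨g, _, _, _⟩ := g
  obtain rfl : f = g := DFunLike.ext _ _ h
  rfl

variable {V W : UQVL.{u}}

/-- The strong unit of `V` absorbs every element up to scaling and translation. -/
theorem eventually_mem_Icc (v : V.carrier) : ∀ᶠ c : ℚ in Filter.atTop,
    0 < c ∧ c⁻¹ • v + (2⁻¹ : ℚ) • V.unit ∈ Set.Icc 0 V.unit := by
  obtain ⟨n, hn⟩ := V.isStrongUnit.2 v
  filter_upwards [Filter.eventually_gt_atTop (0 : ℚ), Filter.eventually_ge_atTop (2 * n : ℚ)]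
    with c hc hcn
  have h1 : |v| ≤ (c * 2⁻¹) • V.unit := by
    refine hn.trans ?_
    rw [← Nat.cast_smul_eq_nsmul ℚ]
    exact smul_le_smul_of_nonneg_right (by linarith) V.isStrongUnit.1
  have h2 : c⁻¹ • (c * 2⁻¹) • V.unit = (2⁻¹ : ℚ) • V.unit := by
    rw [smul_smul, inv_mul_cancel_left₀ hc.ne']
  have h3 : V.unit = (2⁻¹ : ℚ) • V.unit + (2⁻¹ : ℚ) • V.unit := by
    rw [← add_smul]; norm_num
  have hc' : 0 ≤ c⁻¹ := (inv_pos.2 hc).le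
  refine ⟨hc, ?_, ?_⟩
  · have h := smul_le_smul_of_nonneg_left ((neg_le_abs v).trans h1) hc'
    rw [h2, smul_neg] at h
    exact neg_le_iff_add_nonneg'.1 h
  · have h := smul_le_smul_of_nonneg_left ((le_abs_self v).trans h1) hc'
    rw [h2] at h
    conv_rhs => rw [h3]
    exact add_le_add_left h _

/-- Maps between unit intervals of vector lattices that preserve the unit, suprema, sums inside
the interval and division by positive integers. -/
structure IsIntervalHom (g : V.carrier → W.carrier) : Prop where
  map_unit : g V.unit = W.unit
  map_add : ∀ x y, 0 ≤ x → 0 ≤ y → x + y ≤ V.unit → g (x + y) = g x + g y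
  map_inv_smul : ∀ (n : ℕ+), ∀ x ∈ Set.Icc 0 V.unit,
    g (((n : ℕ) : ℚ)⁻¹ • x) = ((n : ℕ) : ℚ)⁻¹ • g x
  map_sup : ∀ x ∈ Set.Icc 0 V.unit, ∀ y ∈ Set.Icc 0 V.unit, g (x ⊔ y) = g x ⊔ g y

namespace IsIntervalHom

variable {g : V.carrier → W.carrier}

theorem map_nsmul (hg : IsIntervalHom g) {x : V.carrier} (h0 : 0 ≤ x) (n : ℕ) (h : n • x ≤ V.unit) :
    g (n • x) = n • g x := by
  induction n with
  | zero =>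
    have h := hg.map_add 0 0 le_rfl le_rfl (by simpa using V.isStrongUnit.1)
    rw [add_zero, left_eq_add] at h
    rw [zero_smul, zero_smul, h]
  | succ n ih =>
    have h1 : n • x ≤ (n + 1) • x := nsmul_le_nsmul_left h0 n.le_succ
    rw [succ_nsmul, hg.map_add _ _ (nsmul_nonneg h0 n) h0 (by rwa [← succ_nsmul]),
      ih (h1.trans h), succ_nsmul]

theorem map_smul (hg : IsIntervalHom g) {q : ℚ} (hq0 : 0 ≤ q) (hq1 : q ≤ 1) {x : V.carrier}
    (hx : x ∈ Set.Icc 0 V.unit) : g (q • x) = q • g x := by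
  have hq : q = (q.num.toNat : ℚ) * (q.den : ℚ)⁻¹ := by
    rw [← Int.cast_natCast q.num.toNat, Int.toNat_of_nonneg (Rat.num_nonneg.2 hq0),
      ← div_eq_mul_inv, Rat.num_div_den]
  have h1 := hg.map_inv_smul ⟨q.den, q.den_pos⟩ x hx
  have h2 := hg.map_nsmul (x := (q.den : ℚ)⁻¹ • x) (smul_nonneg (by positivity) hx.1)
    q.num.toNat (by
      rw [← Nat.cast_smul_eq_nsmul ℚ, smul_smul, ← hq]
      exact (smul_le_of_le_one_left hx.1 hq1).trans hx.2)
  rw [PNat.mk_coe] at h1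
  rwa [h1, ← Nat.cast_smul_eq_nsmul ℚ, ← Nat.cast_smul_eq_nsmul ℚ, smul_smul, smul_smul,
    ← hq] at h2

theorem map_convex (hg : IsIntervalHom g) {q : ℚ} (hq0 : 0 ≤ q) (hq1 : q ≤ 1) {x y : V.carrier}
    (hx : x ∈ Set.Icc 0 V.unit) (hy : y ∈ Set.Icc 0 V.unit) :
    g (q • x + (1 - q) • y) = q • g x + (1 - q) • g y := by
  have hq1' := sub_nonneg.2 hq1
  rw [hg.map_add, hg.map_smul hq0 hq1 hx, hg.map_smul hq1' (sub_le_self _ hq0) hy]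
  · exact smul_nonneg hq0 hx.1
  · exact smul_nonneg hq1' hy.1
  · refine (add_le_add (smul_le_smul_of_nonneg_left hx.2 hq0)
      (smul_le_smul_of_nonneg_left hy.2 hq1')).trans_eq ?_
    rw [← add_smul, add_sub_cancel, one_smul]

theorem map_half_unit (hg : IsIntervalHom g) :
    g ((2⁻¹ : ℚ) • V.unit) = (2⁻¹ : ℚ) • W.unit := by
  rw [hg.map_smul (by norm_num) (by norm_num) ⟨V.isStrongUnit.1, le_rfl⟩, hg.map_unit]

end IsIntervalHom

theorem half_unit_mem : (2⁻¹ : ℚ) • V.unit ∈ Set.Icc 0 V.unit :=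
  ⟨smul_nonneg (by norm_num) V.isStrongUnit.1,
    smul_le_of_le_one_left V.isStrongUnit.1 (by norm_num)⟩

/-- The linear extension of a map defined on the unit interval. -/
noncomputable def extend (g : V.carrier → W.carrier) (v : V.carrier) : W.carrier :=
  (eventually_mem_Icc v).exists.choose •
    (g ((eventually_mem_Icc v).exists.choose⁻¹ • v + (2⁻¹ : ℚ) • V.unit) - (2⁻¹ : ℚ) • W.unit)

variable {g : V.carrier → W.carrier}

/-- The point at scale `d` is the convex combination, with weight `c / d`, of the point at scale `c`
and the centre of the interval. So the scale chosen in `extend` is immaterial. -/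
theorem scaled_eq_of_le (hg : IsIntervalHom g) {v : V.carrier} {c d : ℚ} (hc : 0 < c)
    (hcd : c ≤ d) (hv : c⁻¹ • v + (2⁻¹ : ℚ) • V.unit ∈ Set.Icc 0 V.unit) :
    d • (g (d⁻¹ • v + (2⁻¹ : ℚ) • V.unit) - (2⁻¹ : ℚ) • W.unit) =
      c • (g (c⁻¹ • v + (2⁻¹ : ℚ) • V.unit) - (2⁻¹ : ℚ) • W.unit) := by
  have hd : 0 < d := hc.trans_le hcd
  have h := hg.map_convex (q := c / d) (by positivity) ((div_le_one hd).2 hcd) hv half_unit_mem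
  have h1 : (c / d) • (c⁻¹ • v + (2⁻¹ : ℚ) • V.unit) + (1 - c / d) • (2⁻¹ : ℚ) • V.unit =
      d⁻¹ • v + (2⁻¹ : ℚ) • V.unit := by
    match_scalars <;> field_simp
    ring
  rw [h1, hg.map_half_unit] at h
  rw [h]
  match_scalars <;> field_simp
  ring

theorem extend_eq (hg : IsIntervalHom g) {v : V.carrier} {c : ℚ} (hc : 0 < c)
    (hv : c⁻¹ • v + (2⁻¹ : ℚ) • V.unit ∈ Set.Icc 0 V.unit) :
    extend g v = c • (g (c⁻¹ • v + (2⁻¹ : ℚ) • V.unit) - (2⁻¹ : ℚ) • W.unit) := by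
  obtain ⟨hd, hv'⟩ := (eventually_mem_Icc v).exists.choose_spec
  rcases le_total c (eventually_mem_Icc v).exists.choose with h | h
  · exact scaled_eq_of_le hg hc h hv
  · exact (scaled_eq_of_le hg hd h hv').symm

theorem extend_of_mem (hg : IsIntervalHom g) {v : V.carrier} (hv : v ∈ Set.Icc 0 V.unit) :
    extend g v = g v := by
  have h := hg.map_convex (q := 2⁻¹) (by norm_num) (by norm_num) hv ⟨V.isStrongUnit.1, le_rfl⟩
  have h2 : (1 - 2⁻¹ : ℚ) = 2⁻¹ := by norm_num
  rw [h2] at h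
  rw [extend_eq hg two_pos, h, hg.map_unit, add_sub_cancel_right, smul_inv_smul₀ two_ne_zero]
  refine ⟨add_nonneg (smul_nonneg (by norm_num) hv.1) half_unit_mem.1, ?_⟩
  refine (add_le_add_left (smul_le_smul_of_nonneg_left hv.2 (by norm_num)) _).trans_eq ?_
  rw [← add_smul]
  norm_num

theorem extend_add (hg : IsIntervalHom g) (v w : V.carrier) :
    extend g (v + w) = extend g v + extend g w := by
  -- The midpoint of the points for `v` and `w` at scale `c` is the point for `v + w` at scale `2 *
  -- c`.
  obtain ⟨c, ⟨hc, hv⟩, -, hw⟩ := ((eventually_mem_Icc v).and (eventually_mem_Icc w)).exists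
  have h := hg.map_convex (q := 2⁻¹) (by norm_num) (by norm_num) hv hw
  have hmem : (2⁻¹ : ℚ) • (c⁻¹ • v + (2⁻¹ : ℚ) • V.unit) +
      (1 - 2⁻¹ : ℚ) • (c⁻¹ • w + (2⁻¹ : ℚ) • V.unit) ∈ Set.Icc 0 V.unit :=
    convex_Icc (𝕜 := ℚ) 0 V.unit hv hw (by norm_num) (by norm_num) (by norm_num)
  have h1 : (2⁻¹ : ℚ) • (c⁻¹ • v + (2⁻¹ : ℚ) • V.unit) +
      (1 - 2⁻¹ : ℚ) • (c⁻¹ • w + (2⁻¹ : ℚ) • V.unit) =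
        (2 * c)⁻¹ • (v + w) + (2⁻¹ : ℚ) • V.unit := by
    match_scalars <;> field_simp <;> ring
  rw [h1] at h hmem
  rw [extend_eq hg hc hv, extend_eq hg hc hw, extend_eq hg (mul_pos two_pos hc) hmem, h]
  match_scalars <;> field_simp <;> ring

theorem smul_sup_of_pos {c : ℚ} (hc : 0 < c) (v w : V.carrier) :
    c • (v ⊔ w) = c • v ⊔ c • w :=
  (OrderIso.smulRight hc).map_sup v w

theorem extend_sup (hg : IsIntervalHom g) (v w : V.carrier) :
    extend g (v ⊔ w) = extend g v ⊔ extend g w := by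
  obtain ⟨c, ⟨hc, hv⟩, -, hw⟩ := ((eventually_mem_Icc v).and (eventually_mem_Icc w)).exists
  have h := hg.map_sup _ hv _ hw
  have hmem : _ ⊔ _ ∈ Set.Icc 0 V.unit := ⟨hv.1.trans le_sup_left, sup_le hv.2 hw.2⟩
  rw [← sup_add, ← smul_sup_of_pos (inv_pos.2 hc)] at h hmem
  rw [extend_eq hg hc hv, extend_eq hg hc hw, extend_eq hg hc hmem, h, sup_sub,
    smul_sup_of_pos hc]

/-- The morphism of vector lattices extending a map of unit intervals. -/
noncomputable def extendHom (hg : IsIntervalHom g) : V ⟶ W :=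
  let f : V.carrier →+ W.carrier := AddMonoidHom.mk' (extend g) (extend_add hg)
  { toLinearMap := f.toRatLinearMap
    map_sup' := extend_sup hg
    map_inf' := fun x y => by
      change f (x ⊓ y) = f x ⊓ f y
      have h : f (-x ⊔ -y) = f (-x) ⊔ f (-y) := extend_sup hg (-x) (-y)
      rw [← neg_inf, map_neg, map_neg, map_neg, ← neg_inf] at h
      exact neg_injective h
    map_unit' := (extend_of_mem hg ⟨V.isStrongUnit.1, le_rfl⟩).trans hg.map_unit }

open Classical in
/-- A homomorphism of DMV-algebras between unit intervals, extended by `0`. -/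
noncomputable def intervalMap (φ : gammaQ.obj V ⟶ gammaQ.obj W) (x : V.carrier) : W.carrier :=
  if h : x ∈ Set.Icc 0 V.unit then (φ.toFun ⟨x, h⟩ : Set.Icc (0 : W.carrier) W.unit).1 else 0

theorem intervalMap_of_mem (φ : gammaQ.obj V ⟶ gammaQ.obj W) {x : V.carrier}
    (h : x ∈ Set.Icc 0 V.unit) :
    intervalMap φ x = (φ.toFun ⟨x, h⟩ : Set.Icc (0 : W.carrier) W.unit).1 :=
  dif_pos h

theorem intervalMap_mem (φ : gammaQ.obj V ⟶ gammaQ.obj W) {x : V.carrier}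
    (h : x ∈ Set.Icc 0 V.unit) : intervalMap φ x ∈ Set.Icc 0 W.unit := by
  rw [intervalMap_of_mem φ h]
  exact (φ.toFun ⟨x, h⟩ : Set.Icc (0 : W.carrier) W.unit).2

theorem intervalMap_inf_add (φ : gammaQ.obj V ⟶ gammaQ.obj W) {x y : V.carrier}
    (hx : x ∈ Set.Icc 0 V.unit) (hy : y ∈ Set.Icc 0 V.unit) :
    intervalMap φ (V.unit ⊓ (x + y)) = W.unit ⊓ (intervalMap φ x + intervalMap φ y) := by
  rw [intervalMap_of_mem φ hx, intervalMap_of_mem φ hy,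
    intervalMap_of_mem φ ⟨le_inf V.isStrongUnit.1 (add_nonneg hx.1 hy.1), inf_le_left⟩]
  exact congrArg Subtype.val (φ.map_add' ⟨x, hx⟩ ⟨y, hy⟩)

theorem intervalMap_unit_sub (φ : gammaQ.obj V ⟶ gammaQ.obj W) {x : V.carrier}
    (hx : x ∈ Set.Icc 0 V.unit) :
    intervalMap φ (V.unit - x) = W.unit - intervalMap φ x := by
  rw [intervalMap_of_mem φ hx,
    intervalMap_of_mem φ ⟨sub_nonneg.2 hx.2, sub_le_self _ hx.1⟩]
  exact congrArg Subtype.val (φ.map_compl' ⟨x, hx⟩)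

theorem intervalMap_zero (φ : gammaQ.obj V ⟶ gammaQ.obj W) : intervalMap φ 0 = 0 := by
  rw [intervalMap_of_mem φ ⟨le_rfl, V.isStrongUnit.1⟩]
  exact congrArg Subtype.val φ.map_zero'

/-- The supremum is the MV-term `(xᶜ + y)ᶜ + y`, by `Gamma.luk_aux`. -/
theorem intervalMap_sup (φ : gammaQ.obj V ⟶ gammaQ.obj W) {x y : V.carrier}
    (hx : x ∈ Set.Icc 0 V.unit) (hy : y ∈ Set.Icc 0 V.unit) :
    intervalMap φ (x ⊔ y) = intervalMap φ x ⊔ intervalMap φ y := by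
  have hc : V.unit - x ∈ Set.Icc 0 V.unit := ⟨sub_nonneg.2 hx.2, sub_le_self _ hx.1⟩
  have hs : V.unit ⊓ (V.unit - x + y) ∈ Set.Icc 0 V.unit :=
    ⟨le_inf V.isStrongUnit.1 (add_nonneg hc.1 hy.1), inf_le_left⟩
  have hd : V.unit - V.unit ⊓ (V.unit - x + y) ∈ Set.Icc 0 V.unit :=
    ⟨sub_nonneg.2 hs.2, sub_le_self _ hs.1⟩
  have h := intervalMap_inf_add φ hd hy
  rw [Gamma.luk_aux, intervalMap_unit_sub φ hs, intervalMap_inf_add φ hc hy,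
    intervalMap_unit_sub φ hx, Gamma.luk_aux, inf_eq_right.2 (sup_le hx.2 hy.2),
    inf_eq_right.2 (sup_le (intervalMap_mem φ hx).2 (intervalMap_mem φ hy).2)] at h
  exact h

theorem isIntervalHom_intervalMap (φ : gammaQ.obj V ⟶ gammaQ.obj W) :
    IsIntervalHom (intervalMap φ) where
  map_unit := by
    have h := intervalMap_unit_sub φ (x := 0) ⟨le_rfl, V.isStrongUnit.1⟩
    rwa [intervalMap_zero, sub_zero, sub_zero] at h
  map_add x y hx hy h := by
    have hx' : x ∈ Set.Icc 0 V.unit := ⟨hx, (le_add_of_nonneg_right hy).trans h⟩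
    have hy' : y ∈ Set.Icc 0 V.unit := ⟨hy, (le_add_of_nonneg_left hx).trans h⟩
    have hc : V.unit - y ∈ Set.Icc 0 V.unit := ⟨sub_nonneg.2 hy'.2, sub_le_self _ hy⟩
    -- Preservation of suprema gives monotonicity, so the sum of the images is not truncated either.
    have hle : intervalMap φ x ≤ W.unit - intervalMap φ y := by
      rw [← intervalMap_unit_sub φ hy', ← sup_eq_right, ← intervalMap_sup φ hx' hc,
        sup_eq_right.2 (le_sub_iff_add_le.2 h)]
    have h1 := intervalMap_inf_add φ hx' hy'
    rwa [inf_eq_right.2 h, inf_eq_right.2 (le_sub_iff_add_le.1 hle)] at h1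
  map_inv_smul n x hx := by
    rw [intervalMap_of_mem φ hx, intervalMap_of_mem φ (Gamma.inv_smul_mem n ⟨x, hx⟩)]
    exact congrArg Subtype.val (φ.map_δ' n ⟨x, hx⟩)
  map_sup _ hx _ hy := intervalMap_sup φ hx hy

end UQVL

/-! ### Fullness, faithfulness and the equivalence -/

theorem gammaQ_full : gammaQ.{u}.Full where
  map_surjective φ := ⟨UQVL.extendHom (UQVL.isIntervalHom_intervalMap φ),
    DMVCat.hom_ext fun x => Subtype.ext <|
      (UQVL.extend_of_mem (UQVL.isIntervalHom_intervalMap φ) x.2).trans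
        (UQVL.intervalMap_of_mem φ x.2)⟩

theorem gammaQ_faithful : gammaQ.{u}.Faithful where
  map_injective {V W f g} h := by
    have hI : ∀ x ∈ Set.Icc 0 V.unit, f.toLinearMap x = g.toLinearMap x := fun x hx =>
      congrArg Subtype.val (congrArg (fun φ : gammaQ.obj V ⟶ gammaQ.obj W =>
        (φ.toFun ⟨x, hx⟩ : Set.Icc (0 : W.carrier) W.unit)) h)
    refine UQVL.hom_ext fun v => ?_
    change f.toLinearMap v = g.toLinearMap v
    obtain ⟨c, hc, hv⟩ := (UQVL.eventually_mem_Icc v).exists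
    have h1 := hI _ hv
    rw [map_add, map_add, hI _ UQVL.half_unit_mem, add_left_inj, map_smul, map_smul] at h1
    exact smul_right_injective _ (inv_pos.2 hc).ne' h1

theorem mainTheorem6 :
    gammaQ.{u} ⋙ DMVCat.forgetToMV.{u} = UQVL.forgetToUAG.{u} ⋙ gamma.{u} ∧
      gammaQ.{u}.IsEquivalence :=
  ⟨rfl, { faithful := gammaQ_faithful, full := gammaQ_full, essSurj := gammaQ_essSurj }⟩
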